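/- Let $G=(V,E,w)$ be a finite simple undirected graph with $n\ge 1$ vertices and edge weights $w\ge 0$ (in the unweighted case all weights are $1$), and let $\operatorname{vol}(G)=\sum_{v\in V}\deg(v)$ be its volume, where $\deg(v)$ is the (weighted) degree. For $\alpha>0$ let the augmented graph $G_\star$ arise from $G$ by multiplying all edge weights by $\alpha$ and adding a new universal vertex $u^\star$ that is joined to every $v\in V$ by an edge of weight $1$. Wilson's algorithm on $G_\star$ with root $u^\star$ works as follows. It sets $R[v]\gets 0$ for all $v$ and $T\gets\{u^\star\}$ and sorts the vertices in ascending order of an integer key with values in $\{0,\dots,n\}$ (for instance the number of neighbours in $G_\star$, or a rank by weighted degree; the keys are part of the input) by bucket sort. Then, for each vertex $v$ in this order, it performs a random walk on $G_\star$ (moving from $x$ to $y$ with probability $w_\star(x,y)/\deg_\star(x)$) from $v$ until $T$ is hit, and adds the loop erasure of this walk to $T$; if the last edge of that path is $\{x,u^\star\}$, then $R[x]$ is increased by $1$. The loop erasure is maintained as a stack during the walk. Time is the number of elementary steps on a random access machine, each consisting of a constant number of memory accesses, comparisons and counter updates, and drawing a random neighbour of a vertex of the given graph $G_\star$ counts as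 one step. Initialization, sorting, loop erasure and the insertion of paths into $T$ are all included. Then there is an absolute constant $C$ such that for every such $G$, every $\alpha>0$, every such choice of keys, every enumeration of the vertices of $G_\star$ and every initial content of the working memory, the expected time of one call of Wilson's algorithm on $G_\star$ with root $u^\star$ is at most $C\cdot(\alpha\operatorname{vol}(G)+n)$. No assumption on connectedness or on the diameter of $G$ is needed; in particular this holds for graphs $G$ of constant diameter. -/

import Mathlib

open scoped NNReal ENNReal

/-! ### Weighted graphs and the augmented graph -/

/-- A simple undirected graph with nonnegative edge weights. `weight u v` is the entry of the
weighted adjacency matrix, hence `0` when `u` and `v` are not adjacent. An unweighted graph is one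
whose edges all have weight `1`. -/
structure WeightedGraph (V : Type*) extends SimpleGraph V where
  weight : V → V → ℝ≥0
  weight_symm : ∀ u v, weight u v = weight v u
  weight_eq_zero : ∀ u v, ¬ Adj u v → weight u v = 0

namespace WeightedGraph

variable {V : Type*}

/-- The (weighted) degree of a vertex. -/
def deg [Fintype V] (G : WeightedGraph V) (v : V) : ℝ≥0 := ∑ u, G.weight v u

/-- The (weighted) volume of a graph, i.e. the sum of all (weighted) degrees. -/
def vol [Fintype V] (G : WeightedGraph V) : ℝ≥0 := ∑ v, G.deg v

/-- The augmented graph: a universal vertex `none` is added and joined to every vertex of `G` by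
an edge of weight `1`; the weights of the edges of `G` are multiplied by `α`. -/
def augment (G : WeightedGraph V) (α : ℝ≥0) : WeightedGraph (Option V) where
  Adj
    | some u, some v => G.Adj u v
    | some _, none => True
    | none, some _ => True
    | none, none => False
  symm := ⟨by
    rintro (_ | u) (_ | v) h
    · exact h
    · trivial
    · trivial
    · exact G.symm.symm _ _ h⟩
  loopless := ⟨by
    rintro (_ | u) h
    · exact h
    · exact G.loopless.irrefl u h⟩
  weight
    | some u, some v => α * G.weight u v
    | some _, none => 1
    | none, some _ => 1
    | none, none => 0
  weight_symm := by
    rintro (_ | u) (_ | v)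
    · rfl
    · rfl
    · rfl
    · exact congrArg (α * ·) (G.weight_symm u v)
  weight_eq_zero := by
    rintro (_ | u) (_ | v) h
    · rfl
    · exact (h trivial).elim
    · exact (h trivial).elim
    · exact mul_eq_zero_of_right α (G.weight_eq_zero u v h)

open Classical in
/-- One step of the random walk on `G` from `u`: the vertex `v` is chosen with probability
`weight u v / deg u`. (At a vertex of degree `0` the walk stays where it is.) -/
noncomputable def randomNeighbor [Fintype V] (G : WeightedGraph V) (u : V) : PMF V :=
  if h : (∑' v, (G.weight u v : ℝ≥0∞)) = 0 then PMF.pure u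
  else PMF.normalize (fun v => (G.weight u v : ℝ≥0∞)) h
    (by rw [tsum_fintype]; exact ENNReal.sum_ne_top.2 fun _ _ => ENNReal.coe_ne_top)

end WeightedGraph

/-! ### Expected running time of a randomized step-by-step computation -/

/-- The distribution of the state of a computation after `t` steps, when `step` is executed
repeatedly from the state `s` with fresh randomness in every step. -/
noncomputable def stateAfter {S : Type*} (step : S → PMF S) (s : S) : ℕ → PMF S
  | 0 => PMF.pure s
  | t + 1 => (stateAfter step s t).bind step

/-- The expected number of steps before the computation reaches a state in `halted`, a set of
states which `step` never leaves: `𝔼[τ] = ∑ₜ ℙ[τ > t]`, where `τ > t` means that the state after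
`t` steps is not in `halted`. It is `∞` if the computation runs forever with positive
probability. -/
noncomputable def expectedSteps {S : Type*} (step : S → PMF S) (halted : Set S) (s : S) : ℝ≥0∞ :=
  ∑' t, (stateAfter step s t).toOuterMeasure haltedᶜ

/-! ### Wilson's algorithm -/

namespace Wilson

/-- The program counter, with the local registers of the respective part of the program. -/
inductive Phase (U : Type*)
  /-- Clear the buckets `d, d - 1, …, 0`. -/
  | clear (d : ℕ)
  /-- Initialize the array cells of the listed vertices and put these vertices into buckets. -/
  | init (l : List U)
  /-- Collect the buckets `d, d - 1, …, 0`, so that `order` becomes sorted by ascending key. -/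
  | collect (d : ℕ)
  /-- Head of the main loop: take the next vertex of `order`. -/
  | next
  /-- Draw the next vertex of the current random walk. -/
  | walk
  /-- The random walk has just moved to `x`. -/
  | visit (x : U)
  /-- The walk has closed a loop at `x`: erase that loop from the path. -/
  | eraseLoop (x : U)
  /-- Join the loop-erased path to the tree; its last remaining vertex gets the parent `x`. -/
  | attach (x : U)
  /-- The algorithm has terminated. -/
  | done

/-- The working memory. Lists are linked lists, accessed only at their head; functions are arrays,
accessed one cell at a time. -/
structure Memory (U : Type*) where
  /-- Buckets for sorting. -/
  bucket : ℕ → List U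
  /-- The vertices from which a random walk has still to be started, in this order. -/
  order : List U
  /-- Membership in the current tree `T`. -/
  inTree : U → Bool
  /-- The loop erasure of the current random walk up to now, most recent vertex first. -/
  path : List U
  /-- Membership in `path`. -/
  onPath : U → Bool
  /-- The edges of the tree, directed towards the root. -/
  parent : U → U
  /-- The values that are returned: `R w` is the number of tree edges that join `w` to the root. -/
  R : U → ℕ

/-- A state of a run of the algorithm. -/
structure State (U : Type*) where
  phase : Phase U
  mem : Memory U

/-- One elementary step of Wilson's algorithm on the graph `G` with root `r`. Every step performs
a constant number of accesses to array cells and list heads, comparisons and pointer or counter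
updates, and at most one call of the random-neighbour oracle of `G`.

Here `verts` is the list of all vertices in the representation of `G`, and `key` is an array of
integers by which the vertices are sorted (in ascending order) before the walks start. -/
noncomputable def step {U : Type*} [Fintype U] [DecidableEq U] (G : WeightedGraph U) (r : U)
    (verts : List U) (key : U → ℕ) (s : State U) : PMF (State U) :=
  let m := s.mem
  match s.phase with
  | .clear 0 => PMF.pure ⟨.init verts, { m with
      bucket := Function.update m.bucket 0 []
      order := []
      path := [] }⟩
  | .clear (d + 1) => PMF.pure ⟨.clear d, { m with
      bucket := Function.update m.bucket (d + 1) [] }⟩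
  | .init (v :: l) => PMF.pure ⟨.init l, { m with
      inTree := Function.update m.inTree v false
      onPath := Function.update m.onPath v false
      R := Function.update m.R v 0
      bucket := Function.update m.bucket (key v) (v :: m.bucket (key v)) }⟩
  | .init [] => PMF.pure ⟨.collect (Fintype.card U), { m with
      inTree := Function.update m.inTree r true }⟩
  | .collect d =>
    match m.bucket d, d with
    | v :: l, _ => PMF.pure ⟨.collect d, { m with
        bucket := Function.update m.bucket d l
        order := v :: m.order }⟩
    | [], d' + 1 => PMF.pure ⟨.collect d', m⟩
    | [], 0 => PMF.pure ⟨.next, m⟩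
  | .next =>
    match m.order with
    | [] => PMF.pure ⟨.done, m⟩
    | v :: l =>
      if m.inTree v then PMF.pure ⟨.next, { m with order := l }⟩
      else PMF.pure ⟨.walk, { m with
        order := l
        path := [v]
        onPath := Function.update m.onPath v true }⟩
  | .walk =>
    match m.path with
    | [] => PMF.pure ⟨.next, m⟩
    | v :: _ => (G.randomNeighbor v).map fun x => ⟨.visit x, m⟩
  | .visit x =>
    match m.path with
    | [] => PMF.pure ⟨.next, m⟩
    | v :: _ =>
      if m.inTree x then
        if x = r then PMF.pure ⟨.attach x, { m with R := Function.update m.R v (m.R v + 1) }⟩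
        else PMF.pure ⟨.attach x, m⟩
      else if m.onPath x then PMF.pure ⟨.eraseLoop x, m⟩
      else PMF.pure ⟨.walk, { m with
        path := x :: m.path
        onPath := Function.update m.onPath x true }⟩
  | .eraseLoop x =>
    match m.path with
    | [] => PMF.pure ⟨.next, m⟩
    | v :: l =>
      if v = x then PMF.pure ⟨.walk, m⟩
      else PMF.pure ⟨.eraseLoop x, { m with
        path := l
        onPath := Function.update m.onPath v false }⟩
  | .attach x =>
    match m.path with
    | [] => PMF.pure ⟨.next, m⟩
    | v :: l => PMF.pure ⟨.attach v, { m with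
        path := l
        onPath := Function.update m.onPath v false
        inTree := Function.update m.inTree v true
        parent := Function.update m.parent v x }⟩
  | .done => PMF.pure s

/-- The expected running time (number of elementary steps) of one call of Wilson's algorithm,
when the working memory has the contents `m₀` at the moment of the call. -/
noncomputable def expectedTime {U : Type*} [Fintype U] [DecidableEq U] (G : WeightedGraph U)
    (r : U) (verts : List U) (key : U → ℕ) (m₀ : Memory U) : ℝ≥0∞ :=
  expectedSteps (step G r verts key) {s | s.phase = .done} ⟨.clear (Fintype.card U), m₀⟩

end Wilson

/-! ### Expectations under a `PMF` and a drift criterion -/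

/-! The proof is a potential argument. The potential is built on the residual, the total augmented
degree of the vertices not yet in the tree; with nothing settled it equals `α * vol + n`. A walk at
an unsettled vertex `v` moves to the root with probability `1 / (α * deg v + 1)`, and then the
residual drops by at least `α * deg v + 1`. So each draw lowers it by at least 1 in expectation,
whatever the rest of the graph looks like (`expect_potential_visit_le`).

All other steps are deterministic and amortized: a draw, weighted by 3, pays for itself, for
inspecting the new vertex, and for pushing and later popping it or starting a loop erasure. Stored
list entries carry prepaid credit: 4 in a bucket, 3 in `order`, 1 in `path`. `step_spec` checks
every transition, and Foster's criterion `expectedSteps_le_of_drift` turns this into a bound by the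
initial potential. -/

/-- The expectation of a nonnegative function under a discrete distribution. -/
noncomputable def PMF.expect {S : Type*} (p : PMF S) (f : S → ℝ≥0∞) : ℝ≥0∞ := ∑' s, p s * f s

namespace PMF

variable {S T : Type*}

theorem expect_pure (s : S) (f : S → ℝ≥0∞) : (PMF.pure s).expect f = f s := by
  rw [expect, tsum_eq_single s]
  · simp
  · intro t ht
    simp [PMF.pure_apply, ht]

theorem expect_bind (p : PMF S) (q : S → PMF T) (f : T → ℝ≥0∞) :
    (p.bind q).expect f = p.expect fun s => (q s).expect f := by
  simp only [expect, PMF.bind_apply, ← ENNReal.tsum_mul_right, ← ENNReal.tsum_mul_left]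
  rw [ENNReal.tsum_comm]
  simp only [mul_assoc]

theorem expect_map (p : PMF S) (g : S → T) (f : T → ℝ≥0∞) :
    (p.map g).expect f = p.expect fun s => f (g s) := by
  simp only [PMF.map, expect_bind, Function.comp_apply, expect_pure]

theorem expect_add (p : PMF S) (f g : S → ℝ≥0∞) :
    (p.expect fun s => f s + g s) = p.expect f + p.expect g := by
  simp only [expect, mul_add, ENNReal.tsum_add]

theorem expect_mono_of_support {p : PMF S} {f g : S → ℝ≥0∞} (h : ∀ s ∈ p.support, f s ≤ g s) :
    p.expect f ≤ p.expect g := by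
  refine ENNReal.tsum_le_tsum fun s => ?_
  by_cases hs : p s = 0
  · simp [hs]
  · gcongr
    exact h s ((p.mem_support_iff s).2 hs)

theorem expect_const (p : PMF S) (c : ℝ≥0∞) : (p.expect fun _ => c) = c := by
  rw [expect, ENNReal.tsum_mul_right, p.tsum_coe, one_mul]

theorem expect_indicator (p : PMF S) (A : Set S) :
    p.expect (A.indicator 1) = p.toOuterMeasure A := by
  rw [expect, PMF.toOuterMeasure_apply]
  congr 1
  ext s
  by_cases hs : s ∈ A <;> simp [hs]

theorem expect_add_apply_mul_le [DecidableEq S] (p : PMF S) {f : S → ℝ≥0∞} {x : S} {b c : ℝ≥0∞}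
    (h : ∀ s, f s + (if s = x then b else 0) ≤ c) : p.expect f + p x * b ≤ c := by
  have hx : (p.expect fun s => if s = x then b else 0) = p x * b := by
    rw [expect, tsum_eq_single x]
    · simp
    · intro t ht
      simp [ht]
  rw [← hx, ← expect_add, ← p.expect_const c]
  exact expect_mono_of_support fun s _ => h s

end PMF

/-- The drift criterion (Foster's criterion): if a nonnegative potential decreases by at least `1`
in expectation in each step before halting, and does not increase in expectation afterwards, then
it bounds the expected number of steps. It is enough that this holds on an invariant set. -/
theorem expectedSteps_le_of_drift {S : Type*} {step : S → PMF S} {halted : Set S} (I : Set S)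
    (f : S → ℝ≥0∞) (hI : ∀ s ∈ I, ∀ t ∈ (step s).support, t ∈ I)
    (hf : ∀ s ∈ I, haltedᶜ.indicator 1 s + (step s).expect f ≤ f s) {s : S} (hs : s ∈ I) :
    expectedSteps step halted s ≤ f s := by
  have hsupp : ∀ t, ∀ s' ∈ (stateAfter step s t).support, s' ∈ I := by
    intro t
    induction t with
    | zero =>
      intro s' h
      rw [stateAfter, PMF.support_pure, Set.mem_singleton_iff] at h
      exact h ▸ hs
    | succ t ih =>
      intro s' h
      rw [stateAfter, PMF.mem_support_bind_iff] at h
      obtain ⟨a, ha, h⟩ := h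
      exact hI a (ih a ha) s' h
  -- Telescoping: the time spent so far plus the expected remaining potential never exceeds the
  -- initial potential.
  have hsum : ∀ t, ∑ i ∈ Finset.range t, (stateAfter step s i).toOuterMeasure haltedᶜ +
      (stateAfter step s t).expect f ≤ f s := by
    intro t
    induction t with
    | zero => simp [stateAfter, PMF.expect_pure]
    | succ t ih =>
      refine le_trans ?_ ih
      rw [Finset.sum_range_succ, add_assoc, stateAfter, PMF.expect_bind,
        ← PMF.expect_indicator, ← PMF.expect_add]
      gcongr
      exact PMF.expect_mono_of_support fun s' h => hf s' (hsupp t s' h)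
  rw [expectedSteps, ENNReal.tsum_eq_iSup_nat]
  exact iSup_le fun t => le_self_add.trans (hsum t)

/-! ### The random walk on the augmented graph -/

namespace WeightedGraph

variable {V : Type*} [Fintype V] (G : WeightedGraph V) (α : ℝ≥0)

theorem tsum_augment_weight (v : V) :
    ∑' x, ((G.augment α).weight (some v) x : ℝ≥0∞) = ((α * G.deg v + 1 : ℝ≥0) : ℝ≥0∞) := by
  rw [tsum_fintype, Fintype.sum_option, ← ENNReal.ofNNReal_finsetSum, ← ENNReal.coe_add, add_comm]
  simp [augment, deg, Finset.mul_sum]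

/-- The root edge has weight 1 out of the total `α * deg v + 1`. The product form cancels directly
against the residual released by `v`. -/
theorem randomNeighbor_augment_none_mul (v : V) :
    (G.augment α).randomNeighbor (some v) none * ((α * G.deg v + 1 : ℝ≥0) : ℝ≥0∞) = 1 := by
  have hne : ((α * G.deg v + 1 : ℝ≥0) : ℝ≥0∞) ≠ 0 := by
    rw [ENNReal.coe_ne_zero]
    positivity
  have h : ∑' x, ((G.augment α).weight (some v) x : ℝ≥0∞) ≠ 0 := by
    rwa [tsum_augment_weight]
  have hw : (G.augment α).weight (some v) none = 1 := rfl
  rw [randomNeighbor, dif_neg h, PMF.normalize_apply, tsum_augment_weight, hw, ENNReal.coe_one,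
    one_mul, ENNReal.inv_mul_cancel hne ENNReal.coe_ne_top]

/-- The total degree, in the augmented graph, of the vertices of `G` outside a set. -/
noncomputable def residual (b : Option V → Bool) : ℝ≥0 :=
  ∑ v, if b (some v) then 0 else α * G.deg v + 1

variable {G α}

theorem residual_anti {b c : Option V → Bool} (h : ∀ v, b v = true → c v = true) :
    G.residual α c ≤ G.residual α b := by
  refine Finset.sum_le_sum fun v _ => ?_
  by_cases hb : b (some v) = true
  · simp [hb, h _ hb]
  · by_cases hc : c (some v) = true <;> simp [hb, hc]

theorem residual_eq_add [DecidableEq V] {b : Option V → Bool} {v : V} (h : b (some v) = false) :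
    G.residual α b = G.residual α (fun u => b u || decide (u = some v)) + (α * G.deg v + 1) := by
  unfold residual
  rw [← Finset.add_sum_erase _ _ (Finset.mem_univ v),
    ← Finset.add_sum_erase _ _ (Finset.mem_univ v), add_comm]
  simp only [h, Option.some.injEq, Bool.false_or, decide_true, if_true, zero_add]
  congr 1
  refine Finset.sum_congr rfl fun u hu => ?_
  simp [Finset.ne_of_mem_erase hu]

theorem residual_false :
    G.residual α (fun _ => false) = α * G.vol + (Fintype.card V : ℝ≥0) := by
  simp [residual, vol, Finset.sum_add_distrib, Finset.mul_sum]

theorem residual_le_false (b : Option V → Bool) :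
    G.residual α b ≤ G.residual α (fun _ => false) :=
  residual_anti fun _ h => by simp at h

end WeightedGraph

/-! ### The potential of a state of Wilson's algorithm -/

namespace Wilson

variable {V : Type*} [Fintype V] [DecidableEq V] {G : WeightedGraph V} {α : ℝ≥0}
  {verts : List (Option V)} {key : Option V → ℕ}

/-- The part of the potential that pays for the lists `order` and `path`. -/
def Memory.listCost {U : Type*} (m : Memory U) : ℝ≥0 := 3 * m.order.length + m.path.length

/-- The number of elements of the buckets `0, …, d - 1`. -/
def bucketCount {U : Type*} (bucket : ℕ → List U) (d : ℕ) : ℕ :=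
  ∑ i ∈ Finset.range d, (bucket i).length

variable (G α verts) in
/-- The potential of a state: an upper bound on the expected remaining number of steps. -/
noncomputable def potential (s : State (Option V)) : ℝ≥0 :=
  let m := s.mem
  match s.phase with
  | .clear d => d + 1 + 5 * verts.length + (Fintype.card (Option V) + 3) +
      3 * G.residual α (fun _ => false)
  | .init l => 5 * l.length + (Fintype.card (Option V) + 3) +
      4 * bucketCount m.bucket (Fintype.card (Option V) + 1) + m.listCost +
      3 * G.residual α (fun _ => false)
  | .collect d => d + 2 + 4 * bucketCount m.bucket (d + 1) + m.listCost + 3 * G.residual α m.inTree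
  | .next => 1 + m.listCost + 3 * G.residual α m.inTree
  | .walk => 2 + m.listCost + 3 * G.residual α m.inTree
  -- Once the walk has hit the tree, the whole path is counted as settled, so the gain falls due at
  -- the draw itself and not during `attach`.
  | .visit x => if m.inTree x then
        3 + m.listCost + 3 * G.residual α (fun u => m.inTree u || decide (u ∈ m.path))
      else 4 + m.listCost + 3 * G.residual α m.inTree
  | .eraseLoop _ => 3 + m.listCost + 3 * G.residual α m.inTree
  | .attach _ => 2 + m.listCost + 3 * G.residual α (fun u => m.inTree u || decide (u ∈ m.path))
  | .done => 0

/-- An invariant of the run of the algorithm, as far as it matters for the running time. -/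
def invariant (V : Type*) [Fintype V] : Set (State (Option V)) := {s |
  match s.phase with
  | .clear d => ∀ i, d < i → i ≤ Fintype.card (Option V) → s.mem.bucket i = []
  | .init _ => True
  | .collect _ | .next | .attach _ | .done => s.mem.inTree none = true
  -- An unsettled path is what makes hitting the root lower the residual. Nothing about `onPath` is
  -- needed: if the stack runs empty, control passes to `next` at a lower potential.
  | .walk | .visit _ | .eraseLoop _ =>
    s.mem.inTree none = true ∧ ∀ u ∈ s.mem.path, s.mem.inTree u = false}

/-! ### Bucket counts -/

/-- Only an inequality, since the bucket `k` may lie outside the counted range. -/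
theorem bucketCount_update_cons_le {U : Type*} (b : ℕ → List U) (k d : ℕ) (v : U) :
    bucketCount (Function.update b k (v :: b k)) d ≤ bucketCount b d + 1 := by
  induction d with
  | zero => simp [bucketCount]
  | succ d ih =>
    unfold bucketCount at *
    rw [Finset.sum_range_succ, Finset.sum_range_succ]
    by_cases h : d = k
    · subst h
      rw [Finset.sum_congr rfl fun i hi => by
        rw [Function.update_of_ne (Finset.mem_range.1 hi).ne]]
      simp [add_assoc]
    · rw [Function.update_of_ne h]
      omega

theorem bucketCount_update_self {U : Type*} (b : ℕ → List U) (d : ℕ) (l : List U) :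
    bucketCount (Function.update b d l) (d + 1) = bucketCount b d + l.length := by
  unfold bucketCount
  rw [Finset.sum_range_succ, Function.update_self, Finset.sum_congr rfl fun i hi => by
    rw [Function.update_of_ne (Finset.mem_range.1 hi).ne]]

/-! ### Drift of a single step -/

/-- For a deterministic step the drift condition is a plain inequality between two potentials. -/
theorem step_spec_of_eq_pure {s t : State (Option V)}
    (h : step (G.augment α) none verts key s = PMF.pure t) (ht : t ∈ invariant V)
    (hle : 1 + potential G α verts t ≤ potential G α verts s) :
    (∀ t ∈ (step (G.augment α) none verts key s).support, t ∈ invariant V) ∧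
      1 + (step (G.augment α) none verts key s).expect
        (fun t => (potential G α verts t : ℝ≥0∞)) ≤ potential G α verts s := by
  rw [h, PMF.support_pure, PMF.expect_pure]
  refine ⟨fun t' ht' => ?_, by exact_mod_cast hle⟩
  rwa [Set.mem_singleton_iff.1 ht']

/-- The main step: from a vertex `v`, the random walk moves to the root with probability
`1 / (α * deg v + 1)`, and then `v` joins the tree. -/
theorem expect_potential_visit_le (m : Memory (Option V)) {v : V} {l : List (Option V)}
    (hroot : m.inTree none = true) (hpath : m.path = some v :: l)
    (hv : m.inTree (some v) = false) :
    1 + (((G.augment α).randomNeighbor (some v)).expect fun x =>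
      (potential G α verts ⟨.visit x, m⟩ : ℝ≥0∞)) ≤ potential G α verts ⟨.walk, m⟩ := by
  have hres := WeightedGraph.residual_eq_add (G := G) (α := α) hv
  -- The whole path gets settled, but the release from its head `v` alone suffices.
  have hanti : G.residual α (fun u => m.inTree u || decide (u ∈ m.path)) ≤
      G.residual α (fun u => m.inTree u || decide (u = some v)) := by
    refine WeightedGraph.residual_anti fun u hu => ?_
    simp only [Bool.or_eq_true, decide_eq_true_eq] at hu ⊢
    refine hu.imp_right fun h => ?_
    simp [hpath, h]
  -- `c` bounds the potential after any draw, and at the root there is slack `b`. Probability times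
  -- slack is exactly 3.
  have key := PMF.expect_add_apply_mul_le ((G.augment α).randomNeighbor (some v))
    (f := fun x => (potential G α verts ⟨.visit x, m⟩ : ℝ≥0∞)) (x := none)
    (b := ((α * G.deg v + 1 : ℝ≥0) : ℝ≥0∞) * 3)
    (c := ((4 + m.listCost + 3 * G.residual α m.inTree : ℝ≥0) : ℝ≥0∞)) (by
      intro x
      by_cases hx : x = none
      · subst hx
        have h : potential G α verts ⟨.visit none, m⟩ + (α * G.deg v + 1) * 3 ≤
            4 + m.listCost + 3 * G.residual α m.inTree := by
          simp only [potential, hroot, if_true]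
          rw [hres]
          rw [← NNReal.coe_le_coe] at *
          push_cast at *
          linarith
        rw [if_pos rfl]
        exact_mod_cast h
      · have h : potential G α verts ⟨.visit x, m⟩ ≤
            4 + m.listCost + 3 * G.residual α m.inTree := by
          simp only [potential]
          split_ifs
          · have h' := WeightedGraph.residual_anti (G := G) (α := α) (b := m.inTree)
              (c := fun u => m.inTree u || decide (u ∈ m.path)) (fun u hu => by simp [hu])
            gcongr
            norm_num
          · exact le_rfl
        rw [if_neg hx, add_zero]
        exact_mod_cast h)
  rw [← mul_assoc, WeightedGraph.randomNeighbor_augment_none_mul, one_mul] at key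
  -- Adding 2 turns the 2 in the `walk` potential into the 4 of `c`, and the 1 into the 3 of `key`.
  refine (ENNReal.add_le_add_iff_right (a := 2) (by simp)).1 ?_
  calc _ = _ + 3 := by ring
    _ ≤ _ := key
    _ = _ := by
      simp only [potential]
      push_cast
      ring

theorem step_spec {s : State (Option V)} (hs : s ∈ invariant V) (hd : s.phase ≠ .done) :
    (∀ t ∈ (step (G.augment α) none verts key s).support, t ∈ invariant V) ∧
      1 + (step (G.augment α) none verts key s).expect
        (fun t => (potential G α verts t : ℝ≥0∞)) ≤ potential G α verts s := by
  obtain ⟨p, m⟩ := s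
  cases p with
  | clear d =>
    cases d with
    | zero =>
      refine step_spec_of_eq_pure rfl trivial ?_
      -- The invariant covers the buckets above 0, and this step empties bucket 0, so no stale
      -- entries survive.
      have hb : bucketCount (Function.update m.bucket 0 []) (Fintype.card (Option V) + 1) = 0 := by
        refine Finset.sum_eq_zero fun i hi => ?_
        rcases Nat.eq_zero_or_pos i with rfl | h
        · simp
        · rw [Function.update_of_ne h.ne', hs i h (Nat.lt_succ_iff.1 (Finset.mem_range.1 hi)),
            List.length_nil]
      simp only [potential, Memory.listCost, hb, List.length_nil]
      rw [← NNReal.coe_le_coe]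
      push_cast
      linarith
    | succ d =>
      refine step_spec_of_eq_pure rfl ?_ ?_
      · intro i hi hi'
        change Function.update m.bucket (d + 1) [] i = []
        by_cases h : i = d + 1
        · simp [h]
        · rw [Function.update_of_ne h]
          exact hs i (by omega) hi'
      · simp only [potential]
        rw [← NNReal.coe_le_coe]
        push_cast
        linarith
  | init l =>
    cases l with
    | nil =>
      refine step_spec_of_eq_pure rfl (by simp [invariant]) ?_
      -- During `init` the potential charges for an empty tree, so by monotonicity the actual
      -- contents of `inTree` are irrelevant.
      have h := WeightedGraph.residual_le_false (G := G) (α := α)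
        (Function.update m.inTree none true)
      simp only [potential, Memory.listCost]
      rw [← NNReal.coe_le_coe] at *
      push_cast
      linarith
    | cons v l =>
      refine step_spec_of_eq_pure rfl trivial ?_
      have h : (bucketCount (Function.update m.bucket (key v) (v :: m.bucket (key v)))
          (Fintype.card (Option V) + 1) : ℝ≥0) ≤
          bucketCount m.bucket (Fintype.card (Option V) + 1) + 1 := by
        exact_mod_cast bucketCount_update_cons_le m.bucket (key v) _ v
      simp only [potential, Memory.listCost, List.length_cons]
      rw [← NNReal.coe_le_coe] at *
      push_cast at *
      linarith
  | collect d =>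
    have hroot : m.inTree none = true := hs
    have hcount : bucketCount m.bucket (d + 1) = bucketCount m.bucket d + (m.bucket d).length :=
      Finset.sum_range_succ _ _
    cases hb : m.bucket d with
    | cons v l =>
      refine step_spec_of_eq_pure (t := ⟨.collect d, { m with
        bucket := Function.update m.bucket d l
        order := v :: m.order }⟩) (by simp [step, hb]) hroot ?_
      simp only [potential, Memory.listCost, bucketCount_update_self, hcount, hb, List.length_cons]
      rw [← NNReal.coe_le_coe]
      push_cast
      linarith
    | nil =>
      cases d with
      | zero =>
        refine step_spec_of_eq_pure (t := ⟨.next, m⟩) (by simp [step, hb]) hroot ?_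
        simp only [potential, hcount, hb]
        rw [← NNReal.coe_le_coe]
        push_cast
        linarith [(bucketCount m.bucket 0).cast_nonneg (α := ℝ)]
      | succ d =>
        refine step_spec_of_eq_pure (t := ⟨.collect d, m⟩) (by simp [step, hb]) hroot ?_
        simp only [potential, hcount, hb, List.length_nil, add_zero]
        rw [← NNReal.coe_le_coe]
        push_cast
        linarith
  | next =>
    have hroot : m.inTree none = true := hs
    cases ho : m.order with
    | nil =>
      refine step_spec_of_eq_pure (t := ⟨.done, m⟩) (by simp [step, ho]) hroot ?_
      simp only [potential]
      rw [add_zero, add_assoc]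
      exact le_self_add
    | cons v l =>
      cases hv : m.inTree v with
      | true =>
        refine step_spec_of_eq_pure (t := ⟨.next, { m with order := l }⟩)
          (by simp [step, ho, hv]) hroot ?_
        simp only [potential, Memory.listCost, ho, List.length_cons]
        rw [← NNReal.coe_le_coe]
        push_cast
        linarith
      | false =>
        refine step_spec_of_eq_pure (t := ⟨.walk, { m with
          order := l
          path := [v]
          onPath := Function.update m.onPath v true }⟩)
          (by simp [step, ho, hv]) ⟨hroot, by simpa using hv⟩ ?_
        simp only [potential, Memory.listCost, ho, List.length_cons, List.length_nil]
        rw [← NNReal.coe_le_coe]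
        push_cast
        linarith [m.path.length.cast_nonneg (α := ℝ)]
  | walk =>
    obtain ⟨hroot, hpath⟩ : m.inTree none = true ∧ ∀ u ∈ m.path, m.inTree u = false := hs
    cases hp : m.path with
    | nil =>
      refine step_spec_of_eq_pure (t := ⟨.next, m⟩) (by simp [step, hp]) hroot ?_
      simp only [potential]
      rw [← NNReal.coe_le_coe]
      push_cast
      linarith
    | cons v l =>
      have hv : m.inTree v = false := hpath v (by simp [hp])
      cases v with
      | none => simp [hroot] at hv
      | some v =>
        have h : step (G.augment α) none verts key ⟨.walk, m⟩ =
            ((G.augment α).randomNeighbor (some v)).map fun x => ⟨.visit x, m⟩ := by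
          simp [step, hp]
        rw [h]
        constructor
        · intro t ht
          rw [PMF.mem_support_map_iff] at ht
          obtain ⟨x, -, rfl⟩ := ht
          exact ⟨hroot, hpath⟩
        · rw [PMF.expect_map]
          exact expect_potential_visit_le m hroot hp hv
  | visit x =>
    obtain ⟨hroot, hpath⟩ : m.inTree none = true ∧ ∀ u ∈ m.path, m.inTree u = false := hs
    cases hp : m.path with
    | nil =>
      refine step_spec_of_eq_pure (t := ⟨.next, m⟩) (by simp [step, hp]) hroot ?_
      simp only [potential, hp, List.not_mem_nil, decide_false, Bool.or_false]
      split_ifs <;> rw [← NNReal.coe_le_coe] <;> push_cast <;> linarith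
    | cons v l =>
      cases hx : m.inTree x with
      | true =>
        by_cases hxr : x = none
        · refine step_spec_of_eq_pure (t := ⟨.attach x, { m with
            R := Function.update m.R v (m.R v + 1) }⟩) (by simp [step, hp, hroot, hxr]) hroot ?_
          simp only [potential, Memory.listCost, hx, if_true]
          rw [← NNReal.coe_le_coe]
          push_cast
          linarith
        · refine step_spec_of_eq_pure (t := ⟨.attach x, m⟩) (by simp [step, hp, hx, hxr]) hroot ?_
          simp only [potential, hx, if_true]
          rw [← NNReal.coe_le_coe]
          push_cast
          linarith
      | false =>
        cases ho : m.onPath x with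
        | true =>
          refine step_spec_of_eq_pure (t := ⟨.eraseLoop x, m⟩) (by simp [step, hp, hx, ho])
            ⟨hroot, hpath⟩ ?_
          simp only [potential, hx]
          rw [if_neg Bool.false_ne_true, ← NNReal.coe_le_coe]
          push_cast
          linarith
        | false =>
          refine step_spec_of_eq_pure (t := ⟨.walk, { m with
            path := x :: m.path
            onPath := Function.update m.onPath x true }⟩) (by simp [step, hp, hx, ho])
            ⟨hroot, ?_⟩ ?_
          · simpa [hx] using hpath
          · simp only [potential, Memory.listCost, hx, List.length_cons]
            rw [if_neg Bool.false_ne_true, ← NNReal.coe_le_coe]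
            push_cast
            linarith
  | eraseLoop x =>
    obtain ⟨hroot, hpath⟩ : m.inTree none = true ∧ ∀ u ∈ m.path, m.inTree u = false := hs
    cases hp : m.path with
    | nil =>
      refine step_spec_of_eq_pure (t := ⟨.next, m⟩) (by simp [step, hp]) hroot ?_
      simp only [potential]
      rw [← NNReal.coe_le_coe]
      push_cast
      linarith
    | cons v l =>
      by_cases hv : v = x
      · refine step_spec_of_eq_pure (t := ⟨.walk, m⟩) (by simp [step, hp, hv]) ⟨hroot, hpath⟩ ?_
        simp only [potential]
        rw [← NNReal.coe_le_coe]
        push_cast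
        linarith
      · refine step_spec_of_eq_pure (t := ⟨.eraseLoop x, { m with
          path := l
          onPath := Function.update m.onPath v false }⟩) (by simp [step, hp, hv])
          ⟨hroot, fun u hu => hpath u (by simp [hp, show u ∈ l from hu])⟩ ?_
        simp only [potential, Memory.listCost, hp, List.length_cons]
        rw [← NNReal.coe_le_coe]
        push_cast
        linarith
  | attach x =>
    have hroot : m.inTree none = true := hs
    cases hp : m.path with
    | nil =>
      refine step_spec_of_eq_pure (t := ⟨.next, m⟩) (by simp [step, hp]) hroot ?_
      simp only [potential, hp, List.not_mem_nil, decide_false, Bool.or_false]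
      rw [← NNReal.coe_le_coe]
      push_cast
      linarith
    | cons v l =>
      refine step_spec_of_eq_pure (t := ⟨.attach v, { m with
        path := l
        onPath := Function.update m.onPath v false
        inTree := Function.update m.inTree v true
        parent := Function.update m.parent v x }⟩) (by simp [step, hp]) ?_ ?_
      · change Function.update m.inTree v true none = true
        by_cases h : none = v
        · simp [← h]
        · rw [Function.update_of_ne h, hroot]
      -- Moving `v` from the path to the tree leaves their union unchanged.
      · have h : G.residual α (fun u => Function.update m.inTree v true u || decide (u ∈ l)) ≤
            G.residual α (fun u => m.inTree u || decide (u ∈ v :: l)) := by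
          refine WeightedGraph.residual_anti fun u hu => ?_
          by_cases huv : u = v
          · simp [huv]
          · simpa [Function.update_of_ne huv, huv] using hu
        simp only [potential, Memory.listCost, hp, List.length_cons]
        rw [← NNReal.coe_le_coe] at *
        push_cast at *
        linarith
  | done => exact absurd rfl hd

/-! ### From single steps to the whole run -/

theorem step_of_phase_eq_done {s : State (Option V)} (hd : s.phase = .done) :
    step (G.augment α) none verts key s = PMF.pure s := by
  obtain ⟨p, m⟩ := s
  subst hd
  rfl

theorem mem_invariant_of_mem_support_step {s : State (Option V)} (hs : s ∈ invariant V) :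
    ∀ t ∈ (step (G.augment α) none verts key s).support, t ∈ invariant V := by
  by_cases hd : s.phase = .done
  · intro t ht
    rw [step_of_phase_eq_done hd, PMF.support_pure, Set.mem_singleton_iff] at ht
    exact ht ▸ hs
  · exact (step_spec hs hd).1

theorem step_drift {s : State (Option V)} (hs : s ∈ invariant V) :
    ({s | s.phase = .done}ᶜ : Set (State (Option V))).indicator 1 s +
      (step (G.augment α) none verts key s).expect (fun t => (potential G α verts t : ℝ≥0∞)) ≤
      potential G α verts s := by
  by_cases hd : s.phase = .done
  · rw [step_of_phase_eq_done hd, PMF.expect_pure, Set.indicator_of_notMem (by simpa using hd),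
      zero_add]
  · rw [Set.indicator_of_mem (by simpa using hd)]
    exact (step_spec hs hd).2

end Wilson

theorem mainTheorem8 :
    ∃ C : ℝ≥0, ∀ (V : Type*) [Fintype V] [DecidableEq V] [Nonempty V]
      (G : WeightedGraph V) (α : ℝ≥0), 0 < α →
      ∀ verts : List (Option V), verts.Nodup → (∀ x, x ∈ verts) →
      ∀ key : Option V → ℕ, (∀ x, key x ≤ Fintype.card V) →
      ∀ m₀ : Wilson.Memory (Option V),
        Wilson.expectedTime (G.augment α) none verts key m₀ ≤
          ((C * (α * G.vol + (Fintype.card V : ℝ≥0)) : ℝ≥0) : ℝ≥0∞) := by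
  -- The initial potential is at most `3 * α * vol + 10 * n + 11`, and `n ≥ 1` absorbs the 11.
  refine ⟨21, fun V _ _ _ G α _ verts hnodup _ key _ m₀ => ?_⟩
  refine (expectedSteps_le_of_drift (Wilson.invariant V)
    (fun t => (Wilson.potential G α verts t : ℝ≥0∞))
    (fun s hs => Wilson.mem_invariant_of_mem_support_step hs)
    (fun s hs => Wilson.step_drift hs) ?_).trans ?_
  · intro i hi hi'
    exact absurd hi (not_lt.2 hi')
  · rw [ENNReal.coe_le_coe]
    have hlen : (verts.length : ℝ≥0) ≤ Fintype.card V + 1 := by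
      have h := hnodup.length_le_card
      rw [Fintype.card_option] at h
      exact_mod_cast h
    have hpos : (1 : ℝ≥0) ≤ Fintype.card V := by
      exact_mod_cast Fintype.card_pos (α := V)
    have hvol : 0 ≤ α * G.vol := zero_le
    simp only [Wilson.potential, WeightedGraph.residual_false, Fintype.card_option]
    push_cast
    rw [← NNReal.coe_le_coe] at *
    push_cast at *
    linarith
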